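/- All triangulated categories here have small coproducts; $\Sigma$ denotes the shift. An object $G$ is compact if $\mathrm{Hom}(G,-)$ preserves coproducts, and a compact generator if moreover $\mathrm{Hom}(\Sigma^nG,X)=0$ for all $n\in\mathbb{Z}$ implies $X=0$. For an object $G$ and an interval $I$ of integers, let $\overline{\langle G\rangle}^{I}$ be the class of all direct summands of objects of the smallest full subcategory that contains all $\Sigma^{-i}G$ with $i\in I$ and is closed under coproducts and extensions. For $G$ compact, the t-structure generated by $G$ is the one with aisles $\mathcal{D}_G^{\le n}=\overline{\langle G\rangle}^{(-\infty,n]}$. Two t-structures are equivalent if $\mathcal{D}_1^{\le -A}\subset\mathcal{D}_2^{\le 0}\subset\mathcal{D}_1^{\le A}$ for some integer $A>0$. A t-structure is in the preferred equivalence class if it is equivalent to the t-structure generated by a compact generator. A triangulated category is weakly approximable if it has a compact generator $G$, a t-structure $(\mathcal{D}^{\le 0},\mathcal{D}^{\ge 0})$ and an integer $A>0$ such that (1) $\Sigma^AG\in\mathcal{D}^{\le 0}$ and $\mathrm{Hom}(\Sigma^{-A}G,X)=0$ for all $X\in\mathcal{D}^{\le 0}$, and (2) every $X\in\mathcal{D}^{\le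 0}$ lies in an exact triangle $E\to X\to D\to\Sigma E$ with $E\in\overline{\langle G\rangle}^{[-A,A]}$ and $D\in\mathcal{D}^{\le -1}$. Consider a recollement of triangulated categories with exact functors $i^*,i^!:\mathcal{D}\to\mathcal{D}_F$, $i_*:\mathcal{D}_F\to\mathcal{D}$, $j^*:\mathcal{D}\to\mathcal{D}_U$, $j_!,j_*:\mathcal{D}_U\to\mathcal{D}$; that is, $i^*\dashv i_*\dashv i^!$ and $j_!\dashv j^*\dashv j_*$, $j^*i_*=0$, the functors $i_*,j_!,j_*$ are fully faithful, and for $X\in\mathcal{D}$ there are exact triangles $j_!j^*X\to X\to i_*i^*X\to\Sigma j_!j^*X$ and $i_*i^!X\to X\to j_*j^*X\to\Sigma i_*i^!X$, natural in $X$, whose first two maps are the (co)units. Given t-structures on $\mathcal{D}_F$ and $\mathcal{D}_U$, the glued t-structure on $\mathcal{D}$ is $$\mathcal{D}^{\le 0}=\{X: i^*X\in\mathcal{D}_F^{\le 0},\ j^*X\in\mathcal{D}_U^{\le 0}\},\qquad \mathcal{D}^{\ge 0}=\{X: i^!X\in\mathcal{D}_F^{\ge 0},\ j^*X\in\mathcal{D}_U^{\ge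 0}\}.$$ Suppose that $\mathcal{D}_U$ is weakly approximable and that $\mathcal{D}$ has a compact generator $G$ with $\mathrm{Hom}(\Sigma^{-n}G,G)=0$ for $n\gg0$. Then: (a) for every compact generator $G_U$ of $\mathcal{D}_U$ there is a compact generator $H$ of $\mathcal{D}$ such that the t-structure on $\mathcal{D}$ generated by $H$ is the gluing of the t-structure on $\mathcal{D}_F$ generated by $i^*H$ and the t-structure on $\mathcal{D}_U$ generated by $G_U$, i.e. $X\in\mathcal{D}_H^{\le 0}$ if and only if $i^*X\in(\mathcal{D}_F)_{i^*H}^{\le 0}$ and $j^*X\in(\mathcal{D}_U)_{G_U}^{\le 0}$; (b) the t-structure on $\mathcal{D}$ glued from any t-structure on $\mathcal{D}_F$ in its preferred equivalence class and any t-structure on $\mathcal{D}_U$ in its preferred equivalence class is in the preferred equivalence class of $\mathcal{D}$. -/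

import Mathlib

open CategoryTheory CategoryTheory.Limits CategoryTheory.Pretriangulated
  CategoryTheory.Triangulated

universe v u u₁ u₂ u₃

namespace Gluing

section OneCategory

variable {C : Type u} [Category.{v} C] [Preadditive C] [HasZeroObject C] [HasShift C ℤ]
  [∀ n : ℤ, (shiftFunctor C n).Additive] [Pretriangulated C]

/-- `G[I]`: the objects `Σ⁻ⁱ G` for `i ∈ I` (here `I` is an interval of integers, possibly
unbounded). -/
inductive shiftsIn (G : C) (I : Set ℤ) : ObjectProperty C
  | mk (i : ℤ) (hi : i ∈ I) : shiftsIn G I (G⟦-i⟧)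

/-- `Coprod(P)`: the smallest full subcategory `S` which contains `P`, is closed under
(small) coproducts, and satisfies `S * S ⊆ S`. -/
inductive coprodClosure (P : ObjectProperty C) : ObjectProperty C
  | of (X : C) (hX : P X) : coprodClosure P X
  | coprod {J : Type v} (X : J → C) (c : Cofan X) (hc : IsColimit c)
      (hX : ∀ j, coprodClosure P (X j)) : coprodClosure P c.pt
  | ext (T : Triangle C) (hT : T ∈ distTriang C) (h₁ : coprodClosure P T.obj₁)
      (h₃ : coprodClosure P T.obj₃) : coprodClosure P T.obj₂

/-- `⟨G⟩^I = smd(Coprod(G[I]))`: all direct summands of objects of `Coprod(G[I])`. -/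
def coprodSmd (G : C) (I : Set ℤ) : ObjectProperty C :=
  (coprodClosure (shiftsIn G I)).retractClosure

/-- The aisle `D_G^{≤ n} = ⟨G⟩^{(-∞, n]}` (for `n = 0`: the aisle `D_G^{≤ 0}` of the t-structure
generated by `G`; in general its shift `Σ⁻ⁿ D_G^{≤ 0}`). -/
def generatedAisle (G : C) (n : ℤ) : ObjectProperty C :=
  coprodSmd G (Set.Iic n)

/-- `G` is compact: `Hom(G, -)`, as a functor to abelian groups, preserves small coproducts. -/
def IsCompactObject (G : C) : Prop :=
  ∀ J : Type v, PreservesColimitsOfShape (Discrete J) (preadditiveCoyoneda.obj (Opposite.op G))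

/-- `G` is a compact generator: it is compact, and an object `X` with `Hom(Σⁿ G, X) = 0` for all
integers `n` is zero. -/
def IsCompactGenerator (G : C) : Prop :=
  IsCompactObject G ∧ ∀ X : C, (∀ (n : ℤ) (f : G⟦n⟧ ⟶ X), f = 0) → IsZero X

/-- Two t-structures are equivalent if `D₁^{≤ -A} ⊆ D₂^{≤ 0} ⊆ D₁^{≤ A}` for some `A > 0`. This
is a condition on the two families of aisles `n ↦ D₁^{≤ n}` and `n ↦ D₂^{≤ n}`. -/
def EquivalentAisles (le₁ le₂ : ℤ → ObjectProperty C) : Prop :=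
  ∃ A : ℤ, 0 < A ∧ le₁ (-A) ≤ le₂ 0 ∧ le₂ 0 ≤ le₁ A

/-- The t-structure `t` lies in the preferred equivalence class: it is equivalent to the
t-structure generated by a compact generator. -/
def InPreferredClass (t : TStructure C) : Prop :=
  ∃ G : C, IsCompactGenerator G ∧ EquivalentAisles (generatedAisle G) t.le

variable (C) in
/-- The triangulated category `C` is weakly approximable. -/
def IsWeaklyApproximable : Prop :=
  HasCoproducts.{v} C ∧
  ∃ (G : C) (t : TStructure C) (A : ℤ), IsCompactGenerator G ∧ 0 < A ∧
    (t.le 0 (G⟦A⟧) ∧ ∀ (X : C), t.le 0 X → ∀ f : G⟦-A⟧ ⟶ X, f = 0) ∧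
    ∀ X : C, t.le 0 X → ∃ (E D : C) (f : E ⟶ X) (g : X ⟶ D) (h : D ⟶ E⟦(1 : ℤ)⟧),
      Triangle.mk f g h ∈ distTriang C ∧ coprodSmd G (Set.Icc (-A) A) E ∧ t.le (-1) D

/-- Two distinguished triangles with isomorphic second maps have isomorphic first objects. -/
lemma nonempty_iso₁ (T T' : Triangle C) (hT : T ∈ distTriang C) (hT' : T' ∈ distTriang C)
    (b : T.obj₂ ≅ T'.obj₂) (c : T.obj₃ ≅ T'.obj₃) (comm : T.mor₂ ≫ c.hom = b.hom ≫ T'.mor₂) :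
    Nonempty (T.obj₁ ≅ T'.obj₁) := by
  obtain ⟨a, ha₁, ha₂⟩ := complete_distinguished_triangle_morphism₁ T T' hT hT' b.hom c.hom comm
  let φ : T ⟶ T' := { hom₁ := a, hom₂ := b.hom, hom₃ := c.hom }
  have : IsIso φ.hom₁ := isIso₁_of_isIso₂₃ φ hT hT' inferInstance inferInstance
  exact ⟨asIso φ.hom₁⟩

end OneCategory

section

variable (DF : Type u₁) [Category.{v} DF] [Preadditive DF] [HasZeroObject DF] [HasShift DF ℤ]
  [∀ n : ℤ, (shiftFunctor DF n).Additive] [Pretriangulated DF]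
  (D : Type u₂) [Category.{v} D] [Preadditive D] [HasZeroObject D] [HasShift D ℤ]
  [∀ n : ℤ, (shiftFunctor D n).Additive] [Pretriangulated D]
  (DU : Type u₃) [Category.{v} DU] [Preadditive DU] [HasZeroObject DU] [HasShift DU ℤ]
  [∀ n : ℤ, (shiftFunctor DU n).Additive] [Pretriangulated DU]

/-- A recollement of the triangulated category `D` by `DF` and `DU`. The functors are
`iUpper = i^*`, `iLower = i_*`, `iShriek = i^!`, `jShriek = j_!`, `jUpper = j^*`,
`jLower = j_*`. -/
structure Recollement where
  iUpper : D ⥤ DF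
  iLower : DF ⥤ D
  iShriek : D ⥤ DF
  jShriek : DU ⥤ D
  jUpper : D ⥤ DU
  jLower : DU ⥤ D
  /-- exactness of the six functors -/
  [iUpperShift : iUpper.CommShift ℤ]
  [iLowerShift : iLower.CommShift ℤ]
  [iShriekShift : iShriek.CommShift ℤ]
  [jShriekShift : jShriek.CommShift ℤ]
  [jUpperShift : jUpper.CommShift ℤ]
  [jLowerShift : jLower.CommShift ℤ]
  [iUpperTri : iUpper.IsTriangulated]
  [iLowerTri : iLower.IsTriangulated]
  [iShriekTri : iShriek.IsTriangulated]
  [jShriekTri : jShriek.IsTriangulated]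
  [jUpperTri : jUpper.IsTriangulated]
  [jLowerTri : jLower.IsTriangulated]
  /-- the adjunctions -/
  adjI : iUpper ⊣ iLower
  adjI' : iLower ⊣ iShriek
  adjJ : jShriek ⊣ jUpper
  adjJ' : jUpper ⊣ jLower
  /-- `j^* i_* = 0` -/
  jUpper_iLower : ∀ X : DF, IsZero (jUpper.obj (iLower.obj X))
  /-- the two natural triangles -/
  d : iUpper ⋙ iLower ⟶ (jUpper ⋙ jShriek) ⋙ shiftFunctor D (1 : ℤ)
  d' : jUpper ⋙ jLower ⟶ (iShriek ⋙ iLower) ⋙ shiftFunctor D (1 : ℤ)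
  triangle : ∀ X : D,
    Triangle.mk (adjJ.counit.app X) (adjI.unit.app X) (d.app X) ∈ distTriang D
  triangle' : ∀ X : D,
    Triangle.mk (adjI'.counit.app X) (adjJ'.unit.app X) (d'.app X) ∈ distTriang D
  /-- full faithfulness -/
  [iLowerFull : iLower.Full]
  [iLowerFaithful : iLower.Faithful]
  [jShriekFull : jShriek.Full]
  [jShriekFaithful : jShriek.Faithful]
  [jLowerFull : jLower.Full]
  [jLowerFaithful : jLower.Faithful]

attribute [instance] Recollement.iUpperShift Recollement.iLowerShift Recollement.iShriekShift
  Recollement.jShriekShift Recollement.jUpperShift Recollement.jLowerShift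
  Recollement.iUpperTri Recollement.iLowerTri Recollement.iShriekTri
  Recollement.jShriekTri Recollement.jUpperTri Recollement.jLowerTri
  Recollement.iLowerFull Recollement.iLowerFaithful Recollement.jShriekFull
  Recollement.jShriekFaithful Recollement.jLowerFull Recollement.jLowerFaithful

end

section

variable {C : Type u₁} [Category.{v} C] [Preadditive C] [HasZeroObject C] [HasShift C ℤ]
  [∀ n : ℤ, (shiftFunctor C n).Additive] [Pretriangulated C]
  {D : Type u₂} [Category.{v} D] [Preadditive D] [HasZeroObject D] [HasShift D ℤ]
  [∀ n : ℤ, (shiftFunctor D n).Additive] [Pretriangulated D]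

/-- If `A ⟶ Y ⟶ F W` is distinguished, its second map being adjoint to `w : L Y ⟶ W`, where
`L ⊣ F` and `F` is fully faithful, then `L A` is the fibre of `w`. -/
lemma nonempty_iso_of_adj {L : D ⥤ C} {F : C ⥤ D} [L.CommShift ℤ] [L.IsTriangulated]
    [F.Full] [F.Faithful] (adj : L ⊣ F) {A Y : D} {U W : C}
    (u : U ⟶ L.obj Y) (w : L.obj Y ⟶ W) (z : W ⟶ U⟦(1 : ℤ)⟧)
    (hu : Triangle.mk u w z ∈ distTriang C)
    (a : A ⟶ Y) (b : F.obj W ⟶ A⟦(1 : ℤ)⟧)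
    (ha : Triangle.mk a (adj.homEquiv _ _ w) b ∈ distTriang D) :
    Nonempty (L.obj A ≅ U) := by
  let e : L.obj (F.obj W) ≅ W := asIso (adj.counit.app W)
  refine nonempty_iso₁ _ _ (L.map_distinguished _ ha) hu (Iso.refl _) e ?_
  change L.map (adj.homEquiv _ _ w) ≫ adj.counit.app W = 𝟙 _ ≫ w
  simp [Adjunction.homEquiv_unit]

end

namespace Recollement

variable {DF : Type u₁} [Category.{v} DF] [Preadditive DF] [HasZeroObject DF] [HasShift DF ℤ]
  [∀ n : ℤ, (shiftFunctor DF n).Additive] [Pretriangulated DF]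
  {D : Type u₂} [Category.{v} D] [Preadditive D] [HasZeroObject D] [HasShift D ℤ]
  [∀ n : ℤ, (shiftFunctor D n).Additive] [Pretriangulated D]
  {DU : Type u₃} [Category.{v} DU] [Preadditive DU] [HasZeroObject DU] [HasShift DU ℤ]
  [∀ n : ℤ, (shiftFunctor DU n).Additive] [Pretriangulated DU]

lemma iShriek_jLower (R : Recollement DF D DU) (X : DU) :
    IsZero (R.iShriek.obj (R.jLower.obj X)) := by
  rw [IsZero.iff_id_eq_zero]
  apply (R.adjI'.homEquiv _ _).symm.injective
  apply (R.adjJ'.homEquiv _ _).symm.injective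
  exact (R.jUpper_iLower _).eq_of_src _ _

lemma glue_zero (R : Recollement DF D DU) (tF : TStructure DF) (tU : TStructure DU)
    {X Y : D} (f : X ⟶ Y)
    (hXF : tF.le 0 (R.iUpper.obj X)) (hXU : tU.le 0 (R.jUpper.obj X))
    (hYF : tF.ge 1 (R.iShriek.obj Y)) (hYU : tU.ge 1 (R.jUpper.obj Y)) : f = 0 := by
  have h₁ : R.adjJ.counit.app X ≫ f = 0 := by
    apply (R.adjJ.homEquiv _ _).injective
    rw [tU.zero' (R.adjJ.homEquiv _ _ (R.adjJ.counit.app X ≫ f)) hXU hYU,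
      tU.zero' (R.adjJ.homEquiv _ _ (0 : R.jShriek.obj (R.jUpper.obj X) ⟶ Y)) hXU hYU]
  obtain ⟨g, hg⟩ := Triangle.yoneda_exact₂ _ (R.triangle X) f h₁
  have h₂ : g = 0 := by
    change R.iLower.obj (R.iUpper.obj X) ⟶ Y at g
    apply (R.adjI'.homEquiv _ _).injective
    exact (tF.zero' _ hXF hYF).trans (tF.zero' _ hXF hYF).symm
  rw [hg, h₂]
  exact comp_zero

lemma glue_exists_triangle [IsTriangulated D] (R : Recollement DF D DU) (tF : TStructure DF)
    (tU : TStructure DU) (X : D) :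
    ∃ (A B : D) (_ : tF.le 0 (R.iUpper.obj A) ∧ tU.le 0 (R.jUpper.obj A))
      (_ : tF.ge 1 (R.iShriek.obj B) ∧ tU.ge 1 (R.jUpper.obj B))
      (f : A ⟶ X) (g : X ⟶ B) (h : B ⟶ A⟦(1 : ℤ)⟧), Triangle.mk f g h ∈ distTriang D := by
  obtain ⟨U, V, hU, hV, u, w, z, huv⟩ := tU.exists_triangle_zero_one (R.jUpper.obj X)
  obtain ⟨Y, y, y', hY⟩ := distinguished_cocone_triangle₁ (R.adjJ'.homEquiv _ _ w)
  obtain ⟨eU⟩ := nonempty_iso_of_adj R.adjJ' u w z huv y y' hY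
  obtain ⟨U', W, hU', hW, u', w', z', huw⟩ := tF.exists_triangle_zero_one (R.iUpper.obj Y)
  obtain ⟨A, a, a', hA⟩ := distinguished_cocone_triangle₁ (R.adjI.homEquiv _ _ w')
  obtain ⟨eF⟩ := nonempty_iso_of_adj R.adjI u' w' z' huw a a' hA
  obtain ⟨B, g, h, hB⟩ := distinguished_cocone_triangle (a ≫ y)
  let O := someOctahedron rfl hA hY hB
  have hO := O.mem
  refine ⟨A, B, ⟨(tF.le 0).prop_of_iso eF.symm hU', ?_⟩, ⟨?_, ?_⟩, _, g, h, hB⟩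
  · have : IsIso (R.jUpper.map a) :=
      (Triangle.isZero₃_iff_isIso₁ _ (R.jUpper.map_distinguished _ hA)).1 (R.jUpper_iLower W)
    exact (tU.le 0).prop_of_iso (asIso (R.jUpper.map a) ≪≫ eU).symm hU
  · have : IsIso (R.iShriek.map O.m₁) :=
      (Triangle.isZero₃_iff_isIso₁ _ (R.iShriek.map_distinguished _ hO)).1 (R.iShriek_jLower V)
    let e : W ≅ R.iShriek.obj (R.iLower.obj W) := asIso (R.adjI'.unit.app W)
    exact (tF.ge 1).prop_of_iso (e ≪≫ asIso (R.iShriek.map O.m₁)) hW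
  · have : IsIso (R.jUpper.map O.m₃) :=
      (Triangle.isZero₁_iff_isIso₂ _ (R.jUpper.map_distinguished _ hO)).1 (R.jUpper_iLower W)
    let e : R.jUpper.obj (R.jLower.obj V) ≅ V := asIso (R.adjJ'.counit.app V)
    exact (tU.ge 1).prop_of_iso (asIso (R.jUpper.map O.m₃) ≪≫ e).symm hV

/-- The t-structure on `D` glued from t-structures on `DF` and `DU` along a recollement. -/
def glue [IsTriangulated D] (R : Recollement DF D DU) (tF : TStructure DF)
    (tU : TStructure DU) : TStructure D where
  le n := fun X ↦ tF.le n (R.iUpper.obj X) ∧ tU.le n (R.jUpper.obj X)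
  ge n := fun X ↦ tF.ge n (R.iShriek.obj X) ∧ tU.ge n (R.jUpper.obj X)
  le_isClosedUnderIsomorphisms n :=
    ⟨fun e h ↦ ⟨(tF.le n).prop_of_iso (R.iUpper.mapIso e) h.1,
      (tU.le n).prop_of_iso (R.jUpper.mapIso e) h.2⟩⟩
  ge_isClosedUnderIsomorphisms n :=
    ⟨fun e h ↦ ⟨(tF.ge n).prop_of_iso (R.iShriek.mapIso e) h.1,
      (tU.ge n).prop_of_iso (R.jUpper.mapIso e) h.2⟩⟩
  le_shift n a n' h X hX :=
    ⟨(tF.le n').prop_of_iso ((R.iUpper.commShiftIso a).app X).symm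
        (tF.le_shift n a n' h _ hX.1),
      (tU.le n').prop_of_iso ((R.jUpper.commShiftIso a).app X).symm
        (tU.le_shift n a n' h _ hX.2)⟩
  ge_shift n a n' h X hX :=
    ⟨(tF.ge n').prop_of_iso ((R.iShriek.commShiftIso a).app X).symm
        (tF.ge_shift n a n' h _ hX.1),
      (tU.ge n').prop_of_iso ((R.jUpper.commShiftIso a).app X).symm
        (tU.ge_shift n a n' h _ hX.2)⟩
  zero' _ _ f hX hY := R.glue_zero tF tU f hX.1 hX.2 hY.1 hY.2
  le_zero_le _ hX := ⟨tF.le_zero_le _ hX.1, tU.le_zero_le _ hX.2⟩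
  ge_one_le _ hX := ⟨tF.ge_one_le _ hX.1, tU.ge_one_le _ hX.2⟩
  exists_triangle_zero_one X := R.glue_exists_triangle tF tU X

end Recollement

end Gluing

/-! Part (a) is realised by `H = Σᵐ G ⊕ j_! GU`, with `m` so large that `j^* Σᵐ G` lies in the aisle
of `GU`. Then `j_! GU` lies in the aisle of `H` and `j^* H` in the aisle of `GU`, and these two
memberships suffice (`generatedAisle_iff`). The functors `i^*`, `j^*` are exact and preserve
coproducts, so they carry the aisle of `H` into the other two. Conversely, the triangle `j_! j^* → 1
→ i_* i^*` at `H` puts `i_* i^* H` in the aisle of `H`, and the same triangle at `X` then exhibits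
`X` as an extension of objects of that aisle.

The real content is that `j^* G` is bounded above (`exists_generatedAisle_jUpper`). For a compact
generator `G₀` of `DU`, the object `j_! G₀` is compact, hence built from a bounded range of shifts
of `G`; by adjunction `Hom(Σ⁻ⁿ G₀, j^* G) = Hom(Σ⁻ⁿ j_! G₀, G)` vanishes for `n ≫ 0`. Weak
approximability turns this vanishing into a bound for the given t-structure
(`le_of_hom_shift_eq_zero`), and puts the aisle of that t-structure inside a shift of the generated
one (`le_generatedAisle`).

For (b), compact generators have comparable aisles, since each is built from boundedly many shifts
of the other; so the gluing from (a) differs from the given one by bounded shifts. Generated aisles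
enter only as classes closed under summands, coproducts and extensions; their truncations are never
needed. -/

namespace Gluing

/-! ### Classes closed under summands, coproducts and extensions. -/

section Closure

variable {C : Type u} [Category.{v} C] [Preadditive C] [HasZeroObject C] [HasShift C ℤ]
  [∀ n : ℤ, (shiftFunctor C n).Additive] [Pretriangulated C]

/-- Closure under direct summands, small coproducts and extensions. -/
structure IsSmdCoprodClosed (Q : ObjectProperty C) : Prop where
  retract {X Y : C} : Retract X Y → Q Y → Q X
  coprod {J : Type v} (X : J → C) (c : Cofan X) : IsColimit c → (∀ j, Q (X j)) → Q c.pt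
  ext (T : Triangle C) : T ∈ distTriang C → Q T.obj₁ → Q T.obj₃ → Q T.obj₂

lemma IsSmdCoprodClosed.iso {Q : ObjectProperty C} (hQ : IsSmdCoprodClosed Q) {X Y : C}
    (e : X ≅ Y) (h : Q X) : Q Y :=
  hQ.retract e.symm.retract h

lemma IsSmdCoprodClosed.of_isZero {Q : ObjectProperty C} (hQ : IsSmdCoprodClosed Q) {X : C}
    (h : IsZero X) : Q X :=
  hQ.coprod (J := PEmpty) PEmpty.elim (Cofan.mk X PEmpty.rec)
    { desc := fun _ ↦ h.to_ _
      fac := fun _ j ↦ j.as.elim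
      uniq := fun _ _ _ ↦ h.eq_of_src _ _ } (fun j ↦ j.elim)

lemma coprodClosure_le {P Q : ObjectProperty C} (hQ : IsSmdCoprodClosed Q) (h : P ≤ Q) :
    coprodClosure P ≤ Q := by
  intro X hX
  induction hX with
  | of X hX => exact h X hX
  | coprod X c hc _ ih => exact hQ.coprod X c hc ih
  | ext T hT _ _ h₁ h₃ => exact hQ.ext T hT h₁ h₃

lemma coprodSmd_le {G : C} {I : Set ℤ} {Q : ObjectProperty C} (hQ : IsSmdCoprodClosed Q)
    (h : ∀ i ∈ I, Q (G⟦-i⟧)) : coprodSmd G I ≤ Q := by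
  rintro X ⟨Y, hY, ⟨r⟩⟩
  exact hQ.retract r (coprodClosure_le hQ (by rintro _ ⟨i, hi⟩; exact h i hi) Y hY)

lemma coprodSmd_shift (G : C) {I : Set ℤ} {i : ℤ} (hi : i ∈ I) : coprodSmd G I (G⟦-i⟧) :=
  ⟨_, .of _ ⟨i, hi⟩, ⟨Retract.refl _⟩⟩

lemma isSmdCoprodClosed_coprodSmd [HasCoproducts.{v} C] (G : C) (I : Set ℤ) :
    IsSmdCoprodClosed (coprodSmd G I) where
  retract r h := by
    obtain ⟨Z, hZ, ⟨r'⟩⟩ := h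
    exact ⟨Z, hZ, ⟨r.trans r'⟩⟩
  coprod X c hc h := by
    choose Y hY r using h
    let r j := (r j).some
    refine ⟨∐ Y, .coprod Y _ (coproductIsCoproduct Y) hY, ⟨
      { i := Cofan.IsColimit.desc hc (fun j ↦ (r j).i ≫ Sigma.ι Y j)
        r := Sigma.desc (fun j ↦ (r j).r ≫ c.inj j)
        retract := Cofan.IsColimit.hom_ext hc _ _ (fun j ↦ by simp) }⟩⟩
  ext T hT h₁ h₃ := by
    have := ObjectProperty.extensionProduct_retractClosure_retractClosure_le
      (coprodClosure (shiftsIn G I)) (coprodClosure (shiftsIn G I)) T.obj₂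
      ⟨_, _, T.mor₁, T.mor₂, T.mor₃, hT, h₁, h₃⟩
    obtain ⟨Y, ⟨A, B, f, g, h, hT', hA, hB⟩, r⟩ := this
    exact ⟨Y, .ext _ hT' hA hB, r⟩

lemma coprodSmd_mono (G : C) {I J : Set ℤ} (h : I ⊆ J) : coprodSmd G I ≤ coprodSmd G J := by
  refine ObjectProperty.monotone_retractClosure fun Y hY ↦ ?_
  induction hY with
  | of X hX => obtain ⟨i, hi⟩ := hX; exact .of _ ⟨i, h hi⟩
  | coprod X c hc _ ih => exact .coprod X c hc ih
  | ext T hT _ _ h₁ h₃ => exact .ext T hT h₁ h₃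

lemma isSmdCoprodClosed_hom_eq_zero (Y : C) :
    IsSmdCoprodClosed (fun X : C ↦ ∀ f : X ⟶ Y, f = 0) where
  retract r h f := by
    rw [← cancel_epi r.r, h (r.r ≫ f), comp_zero]
  coprod X c hc h f :=
    Cofan.IsColimit.hom_ext hc _ _ (fun j ↦ by rw [h j (c.inj j ≫ f), comp_zero])
  ext T hT h₁ h₃ f := by
    obtain ⟨g, rfl⟩ := T.yoneda_exact₂ hT f (h₁ _)
    rw [h₃ g, comp_zero]

lemma IsSmdCoprodClosed.shift {Q : ObjectProperty C} (hQ : IsSmdCoprodClosed Q) (n : ℤ) :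
    IsSmdCoprodClosed (fun X : C ↦ Q (X⟦n⟧)) where
  retract r h := hQ.retract (r.map (shiftFunctor C n)) h
  coprod X c hc h := hQ.coprod (fun j ↦ (X j)⟦n⟧) (Cofan.mk _ (fun j ↦ (c.inj j)⟦n⟧'))
    (isColimitCofanMkObjOfIsColimit (shiftFunctor C n) X _
      (hc.ofIsoColimit (Cofan.ext (Iso.refl _) (by simp)))) h
  ext T hT h₁ h₃ := hQ.ext _ (T.shift_distinguished hT n) h₁ h₃

/-- The objects without nonzero maps to `Y` form a closed class, so only the shifts of `G` need
checking. -/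
lemma hom_eq_zero_of_coprodSmd {G : C} {I : Set ℤ} {X Y : C}
    (h : ∀ i ∈ I, ∀ f : G⟦-i⟧ ⟶ Y, f = 0) (hX : coprodSmd G I X) (f : X ⟶ Y) : f = 0 :=
  coprodSmd_le (isSmdCoprodClosed_hom_eq_zero Y) h X hX f

lemma coprodSmd_shift_obj [HasCoproducts.{v} C] {G : C} {I J : Set ℤ} (n : ℤ)
    (h : ∀ i ∈ I, i - n ∈ J) {X : C} (hX : coprodSmd G I X) : coprodSmd G J (X⟦n⟧) := by
  refine coprodSmd_le ((isSmdCoprodClosed_coprodSmd G J).shift n) (fun i hi ↦ ?_) X hX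
  exact (isSmdCoprodClosed_coprodSmd G J).iso
    ((shiftFunctorAdd' C (-i) n (-(i - n)) (by lia)).app G) (coprodSmd_shift G (h i hi))

lemma generatedAisle_shift [HasCoproducts.{v} C] {G X : C} {m : ℤ} (n k : ℤ) (h : k + n = m)
    (hX : generatedAisle G m X) : generatedAisle G k (X⟦n⟧) :=
  coprodSmd_shift_obj n (fun i hi ↦ by simp only [Set.mem_Iic] at *; lia) hX

lemma generatedAisle_of_shift [HasCoproducts.{v} C] {G X : C} {m : ℤ} (n k : ℤ) (h : k + n = m)
    (hX : generatedAisle G k (X⟦n⟧)) : generatedAisle G m X :=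
  (isSmdCoprodClosed_coprodSmd _ _).iso ((shiftEquiv C n).unitIso.symm.app X)
    (generatedAisle_shift (-n) m (by lia) hX)

lemma generatedAisle_mono (G : C) {m n : ℤ} (h : m ≤ n) :
    generatedAisle G m ≤ generatedAisle G n :=
  coprodSmd_mono G (Set.Iic_subset_Iic.2 h)

lemma generatedAisle_self [HasCoproducts.{v} C] (G : C) : generatedAisle G 0 G :=
  generatedAisle_of_shift 0 0 (by lia) 
    (coprodSmd_shift G (show (0 : ℤ) ∈ Set.Iic (0 : ℤ) by simp))

lemma generatedAisle_le [HasCoproducts.{v} C] {G K : C} {b : ℤ} (h : generatedAisle G b K)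
    (n : ℤ) : generatedAisle K n ≤ generatedAisle G (n + b) :=
  coprodSmd_le (isSmdCoprodClosed_coprodSmd _ _) (fun i hi ↦
    generatedAisle_mono G (by simp only [Set.mem_Iic] at hi; lia) _
      (generatedAisle_shift (-i) (b + i) (by lia) h))

end Closure

section Functor

variable {C : Type u₁} [Category.{v} C] [Preadditive C] [HasZeroObject C] [HasShift C ℤ]
  [∀ n : ℤ, (shiftFunctor C n).Additive] [Pretriangulated C]
  {D : Type u₂} [Category.{v} D] [Preadditive D] [HasZeroObject D] [HasShift D ℤ]
  [∀ n : ℤ, (shiftFunctor D n).Additive] [Pretriangulated D]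

lemma IsSmdCoprodClosed.comap {Q : ObjectProperty D} (hQ : IsSmdCoprodClosed Q) (F : C ⥤ D)
    [F.CommShift ℤ] [F.IsTriangulated] [PreservesColimitsOfSize.{v, v} F] :
    IsSmdCoprodClosed (fun X : C ↦ Q (F.obj X)) where
  retract r h := hQ.retract (r.map F) h
  coprod X c hc h := hQ.coprod (fun j ↦ F.obj (X j)) (Cofan.mk _ (fun j ↦ F.map (c.inj j)))
    (isColimitCofanMkObjOfIsColimit F X _
      (hc.ofIsoColimit (Cofan.ext (Iso.refl _) (by simp)))) h
  ext T hT h₁ h₃ := hQ.ext _ (F.map_distinguished T hT) h₁ h₃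

lemma generatedAisle_map [HasCoproducts.{v} D] (F : C ⥤ D)
    [F.CommShift ℤ] [F.IsTriangulated] [PreservesColimitsOfSize.{v, v} F] {G X : C} {K : D}
    {m n : ℤ} (hG : generatedAisle K n (F.obj G)) (hX : generatedAisle G m X) :
    generatedAisle K (m + n) (F.obj X) := by
  refine coprodSmd_le ((isSmdCoprodClosed_coprodSmd _ _).comap F) (fun i hi ↦ ?_) X hX
  refine (isSmdCoprodClosed_coprodSmd _ _).iso ((F.commShiftIso (-i)).app G).symm ?_
  exact generatedAisle_mono K (by simp only [Set.mem_Iic] at hi; lia) _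
      (generatedAisle_shift (-i) (n + i) (by lia) hG)

end Functor

end Gluing

namespace Gluing

/-! ### Compactness as finite factorization of maps into coproducts. -/

section Compact

variable {C : Type u} [Category.{v} C] [Preadditive C]

/-- Morphisms `K ⟶ ∐ X` into coproducts factor through finite subcoproducts. -/
def FactorsFinitely (K : C) [HasCoproducts.{v} C] : Prop :=
  ∀ (J : Type v) (X : J → C) (φ : K ⟶ ∐ X), ∃ (s : Finset J) (g : ∀ j, K ⟶ X j),
    φ = ∑ j ∈ s, g j ≫ Sigma.ι X j

-- The quotient of the coproduct by the subgroup of finite sums receives the zero map from each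
-- summand, so the quotient map itself is zero.
open Classical in
lemma exists_sum_of_isColimit_addCommGrpCat {J : Type v} (A : J → AddCommGrpCat.{v}) (c : Cofan A)
    (hc : IsColimit c) (x : c.pt) :
    ∃ (s : Finset J) (g : ∀ j, A j), x = ∑ j ∈ s, c.inj j (g j) := by
  let F : (Π₀ j, A j) →+ c.pt := DFinsupp.sumAddHom (fun j ↦ (c.inj j).hom)
  let q : c.pt ⟶ AddCommGrpCat.of (c.pt ⧸ F.range) :=
    AddCommGrpCat.ofHom (QuotientAddGroup.mk' F.range)
  have hq : q = 0 := by
    refine Cofan.IsColimit.hom_ext hc _ _ (fun j ↦ ?_)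
    ext a
    have : c.inj j a ∈ F.range := ⟨DFinsupp.single j a, by simp [F]⟩
    simpa [q] using this
  have hx : x ∈ F.range := by
    have := ConcreteCategory.congr_hom hq x
    simpa [q] using this
  obtain ⟨d, rfl⟩ := hx
  exact ⟨d.support, d, by simp [F, DFinsupp.sumAddHom_apply, DFinsupp.sum]⟩

lemma IsCompactObject.factorsFinitely {C : Type u} [Category.{v} C] [Preadditive C]
    [HasZeroObject C] [HasShift C ℤ]
    [∀ n : ℤ, (shiftFunctor C n).Additive] [Pretriangulated C] [HasCoproducts.{v} C] {K : C}
    (hK : IsCompactObject K) : FactorsFinitely K := by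
  intro J X φ
  have := hK J
  obtain ⟨s, g, h⟩ := exists_sum_of_isColimit_addCommGrpCat _ _
    (isColimitCofanMkObjOfIsColimit (preadditiveCoyoneda.obj (Opposite.op K)) X _
      (coproductIsCoproduct X)) φ
  exact ⟨s, g, h⟩

/-- Finite factorization is surjectivity of the comparison map out of `∐ Hom(K, Y j)`. Injectivity
holds for every `K`: composing with the projections of `∐ Y` recovers the components of a finite
sum. -/
lemma FactorsFinitely.isCompactObject {C : Type u} [Category.{v} C] [Preadditive C]
    [HasZeroObject C] [HasShift C ℤ]
    [∀ n : ℤ, (shiftFunctor C n).Additive] [Pretriangulated C] [HasCoproducts.{v} C] {K : C}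
    (hK : FactorsFinitely K) : IsCompactObject K := by
  classical
  intro J
  refine ⟨fun {X} ↦ ?_⟩
  suffices PreservesColimit (Discrete.functor (X.obj ∘ Discrete.mk))
      (preadditiveCoyoneda.obj (Opposite.op K)) from
    preservesColimit_of_iso_diagram _ (Discrete.natIsoFunctor (F := X)).symm
  generalize X.obj ∘ Discrete.mk = Y
  suffices IsIso (sigmaComparison (preadditiveCoyoneda.obj (Opposite.op K)) Y) from
    PreservesCoproduct.of_iso_comparison _ _
  rw [ConcreteCategory.isIso_iff_bijective]
  have key (j : J) (a : K ⟶ Y j) : sigmaComparison (preadditiveCoyoneda.obj (Opposite.op K)) Y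
      (Sigma.ι (fun j ↦ (preadditiveCoyoneda.obj (Opposite.op K)).obj (Y j)) j a) =
        a ≫ Sigma.ι Y j :=
    ConcreteCategory.congr_hom (ι_comp_sigmaComparison
      (preadditiveCoyoneda.obj (Opposite.op K)) Y j) a
  constructor
  · rw [injective_iff_map_eq_zero]
    intro x hx
    obtain ⟨s, g, rfl⟩ := exists_sum_of_isColimit_addCommGrpCat _ _ (coproductIsCoproduct _) x
    refine Finset.sum_eq_zero (fun j hj ↦ ?_)
    let a (j : J) : K ⟶ Y j := g j
    have h : ∑ j ∈ s, a j ≫ Sigma.ι Y j = 0 := by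
      rw [map_sum] at hx
      exact (Finset.sum_congr rfl (fun j _ ↦ (key j (a j)).symm)).trans hx
    have h' := congr($h ≫ Sigma.π Y j)
    rw [Preadditive.sum_comp, Finset.sum_eq_single j] at h'
    · rw [Category.assoc, Sigma.ι_π_eq_id, Category.comp_id, zero_comp] at h'
      exact (congrArg _ h').trans (map_zero _)
    · intro i _ hi
      rw [Category.assoc, Sigma.ι_π_of_ne _ hi, comp_zero]
    · exact fun h ↦ (h hj).elim
  · intro φ
    obtain ⟨s, g, h⟩ := hK J Y φ
    refine ⟨∑ j ∈ s, Sigma.ι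
      (fun j ↦ (preadditiveCoyoneda.obj (Opposite.op K)).obj (Y j)) j (g j), ?_⟩
    rw [map_sum]
    exact (Finset.sum_congr rfl (fun j _ ↦ key j _)).trans h.symm

variable [HasCoproducts.{v} C]

lemma FactorsFinitely.biprod [HasBinaryBiproducts C] {K L : C} (hK : FactorsFinitely K)
    (hL : FactorsFinitely L) : FactorsFinitely (K ⊞ L) := by
  classical
  intro J X φ
  obtain ⟨s, g, hg⟩ := hK J X (biprod.inl ≫ φ)
  obtain ⟨t, g', hg'⟩ := hL J X (biprod.inr ≫ φ)
  refine ⟨s ∪ t, fun j ↦ biprod.desc (if j ∈ s then g j else 0) (if j ∈ t then g' j else 0), ?_⟩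
  ext
  · rw [hg, Preadditive.comp_sum]
    simp [ite_comp, Finset.sum_ite_mem, Finset.union_inter_cancel_left]
  · rw [hg', Preadditive.comp_sum]
    simp [ite_comp, Finset.sum_ite_mem, Finset.union_inter_cancel_right]

lemma FactorsFinitely.of_adjunction {D : Type u₂} [Category.{v} D] [Preadditive D]
    [HasCoproducts.{v} D] {L : C ⥤ D} {F : D ⥤ C} (adj : L ⊣ F) [F.Additive] [L.Additive]
    [PreservesColimitsOfSize.{v, v} F] {K : C} (hK : FactorsFinitely K) :
    FactorsFinitely (L.obj K) := by
  intro J X φ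
  obtain ⟨s, g, hg⟩ := hK J (fun j ↦ F.obj (X j))
    (adj.homEquiv _ _ φ ≫ inv (sigmaComparison F X))
  refine ⟨s, fun j ↦ (adj.homEquiv _ _).symm (g j), (adj.homEquiv _ _).injective ?_⟩
  rw [← cancel_mono (inv (sigmaComparison F X)), hg, ← adj.homAddEquiv_apply, map_sum,
    Preadditive.sum_comp]
  refine Finset.sum_congr rfl (fun j _ ↦ ?_)
  rw [IsIso.eq_comp_inv, Category.assoc, ι_comp_sigmaComparison, adj.homAddEquiv_apply,
    adj.homEquiv_naturality_right, Equiv.apply_symm_apply]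

lemma FactorsFinitely.shift [HasShift C ℤ] [∀ n : ℤ, (shiftFunctor C n).Additive]
    {K : C} (hK : FactorsFinitely K) (n : ℤ) : FactorsFinitely (K⟦n⟧) :=
  have : (shiftEquiv C n).inverse.Additive := inferInstanceAs (shiftFunctor C (-n)).Additive
  have : (shiftEquiv C n).functor.Additive := inferInstanceAs (shiftFunctor C n).Additive
  hK.of_adjunction (shiftEquiv C n).toAdjunction

lemma FactorsFinitely.exists_nat_sum {K : C} (hK : FactorsFinitely K) (X : ℕ → C)
    (φ : K ⟶ ∐ (fun j : ULift.{v} ℕ ↦ X j.down)) :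
    ∃ (N : ℕ) (g : ∀ n, K ⟶ X n),
      φ = ∑ n ∈ Finset.range N, g n ≫ Sigma.ι (fun j : ULift.{v} ℕ ↦ X j.down) ⟨n⟩ := by
  classical
  obtain ⟨s, g, rfl⟩ := hK _ _ φ
  obtain ⟨N, hN⟩ := (s.image ULift.down).exists_nat_subset_range
  refine ⟨N, fun n ↦ if ⟨n⟩ ∈ s then g ⟨n⟩ else 0, ?_⟩
  rw [← Finset.sum_subset hN (fun n _ hn ↦ ?_), Finset.sum_image (by simp)]
  · exact Finset.sum_congr rfl (fun j hj ↦ by simp [hj])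
  · have : (⟨n⟩ : ULift.{v} ℕ) ∉ s := fun h ↦ hn (Finset.mem_image.2 ⟨_, h, rfl⟩)
    simp [this]

end Compact

end Gluing

namespace Gluing

section Triangle

variable {C : Type u} [Category.{v} C] [Preadditive C] [HasZeroObject C] [HasShift C ℤ]
  [∀ n : ℤ, (shiftFunctor C n).Additive] [Pretriangulated C]
  {X Y Z W : C} {f : X ⟶ Y} {g : Y ⟶ Z} {h : Z ⟶ X⟦(1 : ℤ)⟧}

lemma exists_desc_of_distTriang (hT : Triangle.mk f g h ∈ distTriang C) (a : Y ⟶ W)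
    (ha : f ≫ a = 0) : ∃ b : Z ⟶ W, a = g ≫ b :=
  Triangle.yoneda_exact₂ _ hT a ha

lemma exists_lift_of_distTriang (hT : Triangle.mk f g h ∈ distTriang C) (a : W ⟶ Y)
    (ha : a ≫ g = 0) : ∃ b : W ⟶ X, a = b ≫ f :=
  Triangle.coyoneda_exact₂ _ hT a ha

lemma exists_lift_of_distTriang₃ (hT : Triangle.mk f g h ∈ distTriang C) (a : W ⟶ Z)
    (ha : a ≫ h = 0) : ∃ b : W ⟶ Y, a = b ≫ g :=
  Triangle.coyoneda_exact₃ _ hT a ha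

lemma distTriang_comp₁₂ (hT : Triangle.mk f g h ∈ distTriang C) : f ≫ g = 0 :=
  comp_distTriang_mor_zero₁₂ _ hT

lemma distTriang_comp₃₁ (hT : Triangle.mk f g h ∈ distTriang C) : h ≫ f⟦(1 : ℤ)⟧' = 0 :=
  comp_distTriang_mor_zero₃₁ _ hT

end Triangle

/-! ### Mapping telescopes and maps into them from compact objects. -/

section Telescope

variable {C : Type u} [Category.{v} C] [HasCoproducts.{v} C]

/-- The coproduct of a sequence of objects. -/
noncomputable abbrev seqCoprod (X : ℕ → C) : C := ∐ (fun j : ULift.{v} ℕ ↦ X j.down)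

/-- The inclusion of the `n`-th term. -/
noncomputable def seqι (X : ℕ → C) (n : ℕ) : X n ⟶ seqCoprod X :=
  Sigma.ι (fun j : ULift.{v} ℕ ↦ X j.down) ⟨n⟩

/-- The endomorphism of `∐ X n` induced by the transition maps `X n ⟶ X (n + 1)`. -/
noncomputable def seqShift {X : ℕ → C} (f : ∀ n, X n ⟶ X (n + 1)) : seqCoprod X ⟶ seqCoprod X :=
  Sigma.desc (fun j ↦ f j.down ≫ seqι X (j.down + 1))

variable {X : ℕ → C}

lemma seqCoprod_hom_ext {Y : C} {a b : seqCoprod X ⟶ Y}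
    (h : ∀ n, seqι X n ≫ a = seqι X n ≫ b) : a = b :=
  Sigma.hom_ext _ _ (fun j ↦ h j.down)

lemma seqι_shift (f : ∀ n, X n ⟶ X (n + 1)) (n : ℕ) :
    seqι X n ≫ seqShift f = f n ≫ seqι X (n + 1) := by
  simp [seqι, seqShift]

lemma seqι_shift_assoc (f : ∀ n, X n ⟶ X (n + 1)) (n : ℕ) {Y : C} (a : seqCoprod X ⟶ Y) :
    seqι X n ≫ seqShift f ≫ a = f n ≫ seqι X (n + 1) ≫ a := by
  rw [← Category.assoc, seqι_shift, Category.assoc]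

lemma seqι_desc {Y : C} (e : ∀ n, X n ⟶ Y) (n : ℕ) :
    seqι X n ≫ Sigma.desc (fun j : ULift.{v} ℕ ↦ e j.down) = e n := by
  simp [seqι]

variable [Preadditive C]

open Classical in
/-- The projection to the `n`-th term. -/
noncomputable def seqπ (X : ℕ → C) (n : ℕ) : seqCoprod X ⟶ X n :=
  Sigma.π (fun j : ULift.{v} ℕ ↦ X j.down) ⟨n⟩

@[simp]
lemma seqι_π (n : ℕ) : seqι X n ≫ seqπ X n = 𝟙 _ := by
  classical
  exact Sigma.ι_π_eq_id _ _

lemma seqι_π_assoc (n : ℕ) {Y : C} (a : X n ⟶ Y) : seqι X n ≫ seqπ X n ≫ a = a := by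
  rw [← Category.assoc, seqι_π, Category.id_comp]

lemma seqι_π_of_ne {m n : ℕ} (h : m ≠ n) : seqι X m ≫ seqπ X n = 0 := by
  classical
  exact Sigma.ι_π_of_ne _ (by simpa using h)

lemma seqShift_π_zero (f : ∀ n, X n ⟶ X (n + 1)) : seqShift f ≫ seqπ X 0 = 0 :=
  seqCoprod_hom_ext (fun n ↦ by
    rw [seqι_shift_assoc, seqι_π_of_ne (by simp), comp_zero, comp_zero])

lemma seqShift_π_succ (f : ∀ n, X n ⟶ X (n + 1)) (n : ℕ) :
    seqShift f ≫ seqπ X (n + 1) = seqπ X n ≫ f n :=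
  seqCoprod_hom_ext (fun m ↦ by
    rw [seqι_shift_assoc]
    by_cases h : m = n
    · subst h; rw [seqι_π, Category.comp_id, seqι_π_assoc]
    · rw [seqι_π_of_ne (by simpa using h), ← Category.assoc, seqι_π_of_ne h, comp_zero, zero_comp])

variable {K : C} (hK : FactorsFinitely K)
include hK

lemma FactorsFinitely.exists_seq (φ : K ⟶ seqCoprod X) :
    ∃ N : ℕ, φ = ∑ n ∈ Finset.range N, φ ≫ seqπ X n ≫ seqι X n ∧
      ∀ n, N ≤ n → φ ≫ seqπ X n = 0 := by
  obtain ⟨N, g, hg⟩ := hK.exists_nat_sum X φ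
  have hπ (n : ℕ) : φ ≫ seqπ X n = if n < N then g n else 0 := by
    rw [hg, Preadditive.sum_comp]
    change ∑ m ∈ _, (g m ≫ seqι X m) ≫ _ = _
    split_ifs with h
    · rw [Finset.sum_eq_single n]
      · simp
      · intro m _ hm
        rw [Category.assoc, seqι_π_of_ne hm, comp_zero]
      · simp [h]
    · refine Finset.sum_eq_zero (fun m hm ↦ ?_)
      rw [Category.assoc, seqι_π_of_ne (by have := Finset.mem_range.1 hm; lia), comp_zero]
  refine ⟨N, hg.trans (Finset.sum_congr rfl fun n hn ↦ ?_), fun n hn ↦ ?_⟩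
  · rw [← Category.assoc, hπ, if_pos (Finset.mem_range.1 hn)]
    rfl
  · rw [hπ, if_neg (by lia)]

/-- If `φ` is fixed by the shift, its component at `0` vanishes and each component determines the
next; compactness of `K` makes the components determine `φ`. -/
lemma FactorsFinitely.eq_zero_of_one_sub_seqShift (f : ∀ n, X n ⟶ X (n + 1))
    (φ : K ⟶ seqCoprod X) (h : φ ≫ (𝟙 _ - seqShift f) = 0) : φ = 0 := by
  have hφ : φ = φ ≫ seqShift f := by
    rwa [Preadditive.comp_sub, Category.comp_id, sub_eq_zero] at h
  have hπ (n : ℕ) : φ ≫ seqπ X n = 0 := by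
    induction n with
    | zero => rw [hφ, Category.assoc, seqShift_π_zero, comp_zero]
    | succ n ih => rw [hφ, Category.assoc, seqShift_π_succ, ← Category.assoc, ih, zero_comp]
  obtain ⟨N, hN, -⟩ := hK.exists_seq φ
  rw [hN]
  exact Finset.sum_eq_zero (fun n _ ↦ by rw [← Category.assoc, hπ, zero_comp])

lemma FactorsFinitely.exists_lift_one_sub_seqShift (f : ∀ n, X n ⟶ X (n + 1)) (N : ℕ)
    (hf : ∀ n, N ≤ n → ∀ x : K ⟶ X n, x ≫ f n = 0) (φ : K ⟶ seqCoprod X) :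
    ∃ ψ : K ⟶ seqCoprod X, ψ ≫ (𝟙 _ - seqShift f) = φ := by
  -- Descending induction on the index, `d` bounding its distance to `N`: beyond `N` the shift kills
  -- `x ≫ seqι X n`, and below `N` one application of `1 - shift` moves the problem to index `n +
  -- 1`.
  have key (d : ℕ) : ∀ (n : ℕ), N ≤ n + d → ∀ (x : K ⟶ X n),
      x ≫ seqι X n ∈ (Preadditive.rightComp K (𝟙 _ - seqShift f)).range := by
    induction d with
    | zero =>
      intro n hn x
      refine ⟨x ≫ seqι X n, ?_⟩
      have : (x ≫ seqι X n) ≫ seqShift f = 0 := by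
        rw [Category.assoc, seqι_shift, ← Category.assoc, hf n hn, zero_comp]
      change (x ≫ seqι X n) ≫ (𝟙 _ - seqShift f) = _
      rw [Preadditive.comp_sub, this, Category.comp_id, sub_zero]
    | succ d ih =>
      intro n hn x
      have h₁ : (x ≫ seqι X n) ≫ (𝟙 _ - seqShift f) ∈
        (Preadditive.rightComp K (𝟙 _ - seqShift f)).range := ⟨_, rfl⟩
      have h₂ := add_mem h₁ (ih (n + 1) (by lia) (x ≫ f n))
      have h₃ : (x ≫ seqι X n) ≫ (𝟙 _ - seqShift f) + (x ≫ f n) ≫ seqι X (n + 1) =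
          x ≫ seqι X n := by
        rw [Preadditive.comp_sub, Category.comp_id, Category.assoc, seqι_shift, Category.assoc,
          sub_add_cancel]
      rwa [h₃] at h₂
  obtain ⟨M, hM, -⟩ := hK.exists_seq φ
  have : φ ∈ (Preadditive.rightComp K (𝟙 _ - seqShift f)).range := by
    rw [hM]
    refine sum_mem (fun n _ ↦ ?_)
    rw [← Category.assoc]
    exact key N n (by lia) _
  obtain ⟨ψ, hψ⟩ := this
  exact ⟨ψ, hψ⟩

/-- The solution `y` of `y - y ≫ shift = c 0 ≫ seqι X 0` has `n`-th component `c n`, and by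
compactness only finitely many components are nonzero. -/
lemma FactorsFinitely.exists_eq_zero (f : ∀ n, X n ⟶ X (n + 1)) [IsIso (𝟙 _ - seqShift f)]
    (c : ∀ n, K ⟶ X n) (hc : ∀ n, c n ≫ f n = c (n + 1)) : ∃ n, c n = 0 := by
  obtain ⟨y, hy⟩ : ∃ y : K ⟶ seqCoprod X, c 0 ≫ seqι X 0 = y - y ≫ seqShift f := by
    refine ⟨(c 0 ≫ seqι X 0) ≫ inv (𝟙 _ - seqShift f), ?_⟩
    generalize c 0 ≫ seqι X 0 = z
    have h : (z ≫ inv (𝟙 _ - seqShift f)) ≫ (𝟙 _ - seqShift f) = z := by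
      rw [Category.assoc, IsIso.inv_hom_id, Category.comp_id]
    rw [Preadditive.comp_sub, Category.comp_id] at h
    exact h.symm
  have hπ (n : ℕ) : y ≫ seqπ X n = c n := by
    induction n with
    | zero =>
      have := congr($hy ≫ seqπ X 0)
      simpa [Preadditive.sub_comp, seqShift_π_zero] using this.symm
    | succ n ih =>
      have := congr($hy ≫ seqπ X (n + 1))
      rw [Preadditive.sub_comp, Category.assoc, Category.assoc, seqι_π_of_ne (by simp), comp_zero,
        seqShift_π_succ, ← Category.assoc, ih, hc] at this
      exact sub_eq_zero.1 this.symm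
  obtain ⟨N, -, hN⟩ := hK.exists_seq y
  exact ⟨N, by rw [← hπ, hN N le_rfl]⟩

end Telescope

section Shift

variable {C : Type u} [Category.{v} C] [HasShift C ℤ]

lemma exists_eq_shift_map {A X : C} {n : ℤ} (x : A⟦n⟧ ⟶ X⟦(1 : ℤ)⟧) :
    ∃ x' : A⟦n - 1⟧ ⟶ X,
      x = (shiftFunctorAdd' C (n - 1) 1 n (by lia)).hom.app A ≫ x'⟦(1 : ℤ)⟧' := by
  obtain ⟨x', hx'⟩ := (shiftFunctor C (1 : ℤ)).map_surjective
    ((shiftFunctorAdd' C (n - 1) 1 n (by lia)).inv.app A ≫ x)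
  exact ⟨x', by rw [hx']; simp⟩

variable [Preadditive C] [∀ n : ℤ, (shiftFunctor C n).Additive]

/-- Connecting maps of cones end in `X⟦1⟧`; injectivity on `Hom(Σⁿ A, -)` for all `n` passes there
by reindexing. -/
lemma eq_zero_of_comp_shift_map {A X Y : C} (f : X ⟶ Y)
    (h : ∀ (n : ℤ) (x : A⟦n⟧ ⟶ X), x ≫ f = 0 → x = 0) {n : ℤ} (x : A⟦n⟧ ⟶ X⟦(1 : ℤ)⟧)
    (hx : x ≫ f⟦(1 : ℤ)⟧' = 0) : x = 0 := by
  obtain ⟨x', rfl⟩ := exists_eq_shift_map x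
  rw [h _ x', Functor.map_zero, comp_zero]
  apply (shiftFunctor C (1 : ℤ)).map_injective
  simpa using hx

end Shift

/-! ### Detecting isomorphisms and homotopy colimits with a compact generator. -/

section Generator

variable {C : Type u} [Category.{v} C] [Preadditive C] [HasZeroObject C] [HasShift C ℤ]
  [∀ n : ℤ, (shiftFunctor C n).Additive] [Pretriangulated C]

variable {G : C} (hG : IsCompactGenerator G)
include hG

lemma IsCompactGenerator.isIso {X Y : C} (f : X ⟶ Y)
    (h₁ : ∀ (n : ℤ) (x : G⟦n⟧ ⟶ X), x ≫ f = 0 → x = 0)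
    (h₂ : ∀ (n : ℤ) (y : G⟦n⟧ ⟶ Y), ∃ x, x ≫ f = y) : IsIso f := by
  obtain ⟨Z, g, h, hT⟩ := distinguished_cocone_triangle f
  refine (Triangle.isZero₃_iff_isIso₁ _ hT).1 (hG.2 _ (fun n z ↦ ?_))
  change G⟦n⟧ ⟶ Z at z
  have hz : z ≫ h = 0 := by
    apply eq_zero_of_comp_shift_map f h₁
    have : h ≫ f⟦(1 : ℤ)⟧' = 0 := distTriang_comp₃₁ hT
    rw [Category.assoc, this, comp_zero]
  obtain ⟨y, rfl⟩ := exists_lift_of_distTriang₃ hT z hz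
  obtain ⟨x, rfl⟩ := h₂ n y
  have : f ≫ g = 0 := distTriang_comp₁₂ hT
  change (x ≫ f) ≫ g = 0
  rw [Category.assoc, this, comp_zero]

variable [HasCoproducts.{v} C]

lemma IsCompactGenerator.factorsFinitely (n : ℤ) : FactorsFinitely (G⟦n⟧) :=
  hG.1.factorsFinitely.shift n

lemma IsCompactGenerator.isIso_one_sub_seqShift {X : ℕ → C} (f : ∀ n, X n ⟶ X (n + 1))
    (hf : ∀ k : ℤ, ∃ N : ℕ, ∀ n, N ≤ n → ∀ x : G⟦k⟧ ⟶ X n, x ≫ f n = 0) :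
    IsIso (𝟙 _ - seqShift f) :=
  hG.isIso _ (fun k ↦ (hG.factorsFinitely k).eq_zero_of_one_sub_seqShift f)
    (fun k φ ↦ by
      obtain ⟨N, hN⟩ := hf k
      exact (hG.factorsFinitely k).exists_lift_one_sub_seqShift f N hN φ)

/-- A sequence of objects over `X` which eventually induces bijections on `Hom(Σᵏ G, -)` for every
`k` has homotopy colimit `X`. -/
lemma IsCompactGenerator.prop_of_sequence {Q : ObjectProperty C} (hQ : IsSmdCoprodClosed Q)
    (hQ₁ : ∀ X, Q X → Q (X⟦(1 : ℤ)⟧)) {X : C} {E : ℕ → C} (hE : ∀ n, Q (E n))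
    (f : ∀ n, E n ⟶ E (n + 1)) (e : ∀ n, E n ⟶ X) (hf : ∀ n, f n ≫ e (n + 1) = e n)
    (h : ∀ k : ℤ, ∃ N : ℕ, ∀ n, N ≤ n → (∀ x : G⟦k⟧ ⟶ E n, x ≫ e n = 0 → x = 0) ∧
      ∀ y : G⟦k⟧ ⟶ X, ∃ x, x ≫ e n = y) : Q X := by
  obtain ⟨Y, p, δ, hT⟩ := distinguished_cocone_triangle (𝟙 _ - seqShift f)
  have hp : (𝟙 _ - seqShift f) ≫ p = 0 := distTriang_comp₁₂ hT
  let q : seqCoprod E ⟶ X := Sigma.desc (fun j : ULift.{v} ℕ ↦ e j.down)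
  have hq (n : ℕ) : seqι E n ≫ q = e n := seqι_desc e n
  obtain ⟨y, hy⟩ : ∃ y : Y ⟶ X, q = p ≫ y := exists_desc_of_distTriang hT q (by
    refine seqCoprod_hom_ext (fun n ↦ ?_)
    rw [← Category.assoc, Preadditive.comp_sub, Category.comp_id, seqι_shift,
      Preadditive.sub_comp, Category.assoc, hq, hq, hf, sub_self, comp_zero])
  have hZ : Q (seqCoprod E) := hQ.coprod _ _ (coproductIsCoproduct _) (fun j ↦ hE j.down)
  -- `Y` is the homotopy colimit of `E`, an extension of `(∐ E)⟦1⟧` by `∐ E`.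
  have hY : Q Y := hQ.ext _ (rot_of_distTriang _ hT) hZ (hQ₁ _ hZ)
  have hιp (n : ℕ) : seqι E n ≫ p = f n ≫ seqι E (n + 1) ≫ p := by
    have := seqι E n ≫= hp
    rwa [Preadditive.sub_comp, Preadditive.comp_sub, Category.id_comp, seqι_shift_assoc, comp_zero,
      sub_eq_zero] at this
  have : IsIso y := by
    refine hG.isIso y (fun k w hw ↦ ?_) (fun k x ↦ ?_)
    · obtain ⟨N, hN⟩ := h k
      have hwδ : w ≫ δ = 0 := by
        refine eq_zero_of_comp_shift_map (𝟙 _ - seqShift f)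
          (fun k ↦ (hG.factorsFinitely k).eq_zero_of_one_sub_seqShift f) _ ?_
        have : δ ≫ (𝟙 _ - seqShift f)⟦(1 : ℤ)⟧' = 0 := distTriang_comp₃₁ hT
        rw [Category.assoc, this, comp_zero]
      obtain ⟨φ, rfl⟩ : ∃ φ : G⟦k⟧ ⟶ seqCoprod E, w = φ ≫ p :=
        exists_lift_of_distTriang₃ hT w hwδ
      -- In `Y` the finitely many components of `φ` can be pushed along the transition maps to one
      -- index beyond `N`, where injectivity of `e` applies.
      have key (n : ℕ) (a : G⟦k⟧ ⟶ E n) (M : ℕ) (hM : n ≤ M) :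
          ∃ x : G⟦k⟧ ⟶ E M, a ≫ seqι E n ≫ p = x ≫ seqι E M ≫ p := by
        induction M, hM using Nat.le_induction with
        | base => exact ⟨a, rfl⟩
        | succ M _ ih =>
          obtain ⟨x, hx⟩ := ih
          exact ⟨x ≫ f M, by rw [hx, hιp, Category.assoc]⟩
      obtain ⟨M, hM, -⟩ := (hG.factorsFinitely k).exists_seq φ
      have hsum : ∃ z : G⟦k⟧ ⟶ E (max M N), φ ≫ p = z ≫ seqι E (max M N) ≫ p := by
        choose! z hz using fun (n : ℕ) (hn : n ≤ max M N) ↦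
          key n (φ ≫ seqπ E n) (max M N) hn
        refine ⟨∑ n ∈ Finset.range M, z n, ?_⟩
        rw [hM, Preadditive.sum_comp, Preadditive.sum_comp]
        refine Finset.sum_congr rfl (fun n hn ↦ ?_)
        rw [← hz n ((Finset.mem_range.1 hn).le.trans (le_max_left _ _))]
        simp only [Category.assoc]
      obtain ⟨z, hz⟩ := hsum
      rw [hz, Category.assoc, Category.assoc, ← hy, hq] at hw
      rw [hz, (hN _ (le_max_right _ _)).1 z hw, zero_comp]
    · obtain ⟨N, hN⟩ := h k
      obtain ⟨x', rfl⟩ := (hN N le_rfl).2 x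
      exact ⟨x' ≫ seqι E N ≫ p, by rw [Category.assoc, Category.assoc, ← hy, hq]⟩
  exact hQ.iso (asIso y) hY

end Generator

end Gluing

namespace Gluing

open scoped ZeroObject

lemma exists_sequence_of_step {S : ℕ → Type*} (s₀ : S 0) (r : ∀ n, S n → S (n + 1) → Prop)
    (h : ∀ n s, ∃ s', r n s s') : ∃ s : ∀ n, S n, ∀ n, r n (s n) (s (n + 1)) := by
  choose next hnext using h
  exact ⟨fun n ↦ Nat.rec s₀ next n, fun n ↦ hnext n _⟩

/-! ### Building compact objects from a generator; weakly approximable categories. -/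

section

variable {C : Type u} [Category.{v} C] [Preadditive C] [HasZeroObject C] [HasShift C ℤ]
  [∀ n : ℤ, (shiftFunctor C n).Additive] [Pretriangulated C]

/-- `B'` is the cone of the universal map to `B` from the shifts of `G` in the range. By the
octahedral axiom the new fibre `E'` is an extension of that coproduct by `E`. -/
lemma exists_kill_step [IsTriangulated C] [HasCoproducts.{v} C] (G : C) {n n' : ℤ} (hn : n ≤ n')
    {E K B : C} {a : E ⟶ K} {c : K ⟶ B} {b : B ⟶ E⟦(1 : ℤ)⟧}
    (hT : Triangle.mk a c b ∈ distTriang C) (hE : coprodSmd G (Set.Icc (-n) n) E) :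
    ∃ (B' : C) (g : B ⟶ B') (E' : C) (a' : E' ⟶ K) (b' : B' ⟶ E'⟦(1 : ℤ)⟧),
      Triangle.mk a' (c ≫ g) b' ∈ distTriang C ∧ coprodSmd G (Set.Icc (-n') n') E' ∧
        ∀ k ∈ Set.Icc (-n) n, ∀ x : G⟦k⟧ ⟶ B, x ≫ g = 0 := by
  let J : Type v := Σ k : Set.Icc (-n) n, (G⟦k.1⟧ ⟶ B)
  let t : ∐ (fun j : J ↦ G⟦j.1.1⟧) ⟶ B := Sigma.desc (fun j ↦ j.2)
  obtain ⟨B', g, h, hT'⟩ := distinguished_cocone_triangle t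
  obtain ⟨E', a', b', hT''⟩ := distinguished_cocone_triangle₁ (c ≫ g)
  let o := someOctahedron' rfl hT hT' hT''
  have hc := isSmdCoprodClosed_coprodSmd G (Set.Icc (-n) n)
  refine ⟨B', g, E', a', b', hT'', ?_, fun k hk x ↦ ?_⟩
  · refine coprodSmd_mono G (Set.Icc_subset_Icc (by lia) hn) _ (hc.ext _ o.mem hE ?_)
    refine hc.coprod _ _ (coproductIsCoproduct _) (fun j ↦ ?_)
    obtain ⟨⟨k, hk⟩, x⟩ := j
    have := coprodSmd_shift G (I := Set.Icc (-n) n) (i := -k)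
      ⟨by have := hk.2; lia, by have := hk.1; lia⟩
    rwa [neg_neg] at this
  · have hx : x = Sigma.ι (fun j : J ↦ G⟦j.1.1⟧) ⟨⟨k, hk⟩, x⟩ ≫ t := by simp [t]
    have htg : t ≫ g = 0 := distTriang_comp₁₂ hT'
    rw [hx, Category.assoc, htg, comp_zero]

/-- Compact objects are built from finitely many shifts of a compact generator. -/
lemma IsCompactGenerator.exists_coprodSmd [IsTriangulated C] [HasCoproducts.{v} C] {G K : C}
    (hG : IsCompactGenerator G) (hK : FactorsFinitely K) :
    ∃ n : ℤ, coprodSmd G (Set.Icc (-n) n) K := by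
  let P (n : ℕ) (p : Σ B : C, K ⟶ B) : Prop :=
    ∃ (E : C) (a : E ⟶ K) (b : p.1 ⟶ E⟦(1 : ℤ)⟧), Triangle.mk a p.2 b ∈ distTriang C ∧
      coprodSmd G (Set.Icc (-n : ℤ) n) E
  obtain ⟨s, hs⟩ := exists_sequence_of_step (S := fun n ↦ { p // P n p })
    ⟨⟨K, 𝟙 K⟩, 0, 0, 0, contractible_distinguished₁ K,
      (isSmdCoprodClosed_coprodSmd _ _).of_isZero (isZero_zero C)⟩
    (fun n p p' ↦ ∃ g : p.1.1 ⟶ p'.1.1, p.1.2 ≫ g = p'.1.2 ∧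
      ∀ k ∈ Set.Icc (-n : ℤ) n, ∀ x : G⟦k⟧ ⟶ p.1.1, x ≫ g = 0) (by
    rintro n ⟨⟨B, c⟩, E, a, b, hT, hE⟩
    obtain ⟨B', g, E', a', b', hT', hE', hk⟩ :=
      exists_kill_step G (n' := (n + 1 : ℕ)) (by simp) hT hE
    exact ⟨⟨⟨B', c ≫ g⟩, E', a', b', hT', hE'⟩, g, rfl, hk⟩)
  choose g hg hk using hs
  -- Every map from a fixed `Σᵏ G` is eventually killed, so the telescope vanishes; hence `K ⟶ Bₙ`
  -- is zero for some `n`, and `K` is a summand of the fibre `Eₙ`.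
  have : IsIso (𝟙 _ - seqShift g) := hG.isIso_one_sub_seqShift g (fun k ↦
    ⟨k.natAbs, fun n hn x ↦ hk n k ⟨by lia, by lia⟩ x⟩)
  obtain ⟨n, hn⟩ := hK.exists_eq_zero g (fun n ↦ (s n).1.2) hg
  obtain ⟨E, a, b, hT, hE⟩ := (s n).2
  obtain ⟨i, hi⟩ := exists_lift_of_distTriang hT (𝟙 K) (by rw [hn, comp_zero])
  exact ⟨n, (isSmdCoprodClosed_coprodSmd _ _).retract ⟨i, a, hi.symm⟩ hE⟩

lemma IsCompactGenerator.exists_generatedAisle [IsTriangulated C] [HasCoproducts.{v} C] {G K : C}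
    (hG : IsCompactGenerator G) (hK : FactorsFinitely K) : ∃ n : ℤ, generatedAisle G n K := by
  obtain ⟨n, hn⟩ := hG.exists_coprodSmd hK
  exact ⟨n, coprodSmd_mono G (fun i hi ↦ hi.2) _ hn⟩

variable {t : TStructure C} {G : C} {A : ℤ}

lemma hom_shift_eq_zero (hA : ∀ X : C, t.le 0 X → ∀ f : G⟦-A⟧ ⟶ X, f = 0) {m k : ℤ}
    (hk : k ≤ -A - m) {X : C} (hX : t.le m X) (f : G⟦k⟧ ⟶ X) : f = 0 := by
  apply (shiftFunctor C (-A - k)).map_injective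
  have h := hA (X⟦-A - k⟧) (t.le_monotone (show m + A + k ≤ 0 by lia) _
      (t.le_shift m _ _ (by lia) _ hX))
    ((shiftFunctorAdd' C k (-A - k) (-A) (by lia)).hom.app G ≫ f⟦-A - k⟧')
  rw [Functor.map_zero, ← cancel_epi ((shiftFunctorAdd' C k (-A - k) (-A) (by lia)).hom.app G), h,
    comp_zero]

lemma le_shift_of_le (hG : t.le 0 (G⟦A⟧)) (k : ℤ) : t.le (A - k) (G⟦k⟧) :=
  (t.le _).prop_of_iso ((shiftFunctorAdd' C A (k - A) k (by lia)).symm.app G)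
    (t.le_shift 0 (k - A) _ (by lia) _ hG)

lemma distTriang_of_iso₂ {X Y Y' Z : C} {f : X ⟶ Y} {g : Y ⟶ Z} {h : Z ⟶ X⟦(1 : ℤ)⟧}
    (hT : Triangle.mk f g h ∈ distTriang C) (e : Y ≅ Y') :
    Triangle.mk (f ≫ e.hom) (e.inv ≫ g) h ∈ distTriang C := by
  refine isomorphic_distinguished _ hT _
    (Triangle.isoMk _ _ (Iso.refl _) e.symm (Iso.refl _) ?_ ?_ ?_)
  · change (f ≫ e.hom) ≫ e.inv = 𝟙 X ≫ f
    simp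
  · change (e.inv ≫ g) ≫ 𝟙 Z = e.inv ≫ g
    simp
  · change h ≫ (𝟙 X)⟦1⟧' = 𝟙 Z ≫ h
    simp

lemma exists_approximation [HasCoproducts.{v} C]
    (h : ∀ X : C, t.le 0 X → ∃ (E D : C) (f : E ⟶ X) (g : X ⟶ D) (h : D ⟶ E⟦(1 : ℤ)⟧),
      Triangle.mk f g h ∈ distTriang C ∧ coprodSmd G (Set.Icc (-A) A) E ∧ t.le (-1) D)
    (m : ℤ) {X : C} (hX : t.le m X) :
    ∃ (E D : C) (f : E ⟶ X) (g : X ⟶ D) (h : D ⟶ E⟦(1 : ℤ)⟧),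
      Triangle.mk f g h ∈ distTriang C ∧ coprodSmd G (Set.Icc (m - A) (m + A)) E ∧
        t.le (m - 1) D := by
  obtain ⟨E, D, f, g, h, hT, hE, hD⟩ := h (X⟦m⟧) (t.le_shift m m 0 (by lia) _ hX)
  have hT' := distTriang_of_iso₂ (Triangle.shift_distinguished _ hT (-m))
    ((shiftEquiv C m).unitIso.symm.app X)
  refine ⟨_, _, _, _, _, hT', coprodSmd_shift_obj (-m) (fun i hi ↦ ?_) hE,
    t.le_shift _ _ _ (by lia) _ hD⟩
  exact ⟨by have := hi.1; lia, by have := hi.2; lia⟩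

/-- In a weakly approximable category, the condition `Hom(Σ⁻ⁿ G, F) = 0` for `n ≫ 0` implies that
`F` is bounded above. -/
lemma le_of_hom_shift_eq_zero [IsTriangulated C] [HasCoproducts.{v} C] (hG : IsCompactGenerator G)
    (hGA : t.le 0 (G⟦A⟧))
    (h : ∀ X : C, t.le 0 X → ∃ (E D : C) (f : E ⟶ X) (g : X ⟶ D) (h : D ⟶ E⟦(1 : ℤ)⟧),
      Triangle.mk f g h ∈ distTriang C ∧ coprodSmd G (Set.Icc (-A) A) E ∧ t.le (-1) D)
    {F : C} {N : ℤ} (hF : ∀ n, N ≤ n → ∀ f : G⟦-n⟧ ⟶ F, f = 0) : t.le (N + A) F := by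
  obtain ⟨X, Y, hX, hY, f, g, d, hT⟩ := t.exists_triangle F (N + A) (N + A + 1) rfl
  -- Every map to `F` from an object bounded above dies in `Y`: its restriction to the approximation
  -- `E` vanishes by `hF`, so it factors through `D`, whose bound is one lower.
  have key (i : ℕ) : ∀ {Z : C}, t.le (N + A + i) Z → ∀ z : Z ⟶ F, z ≫ g = 0 := by
    induction i with
    | zero =>
      intro Z hZ z
      exact t.zero_of_isLE_of_isGE _ (N + A) (N + A + 1) (by lia) ⟨by simpa using hZ⟩ ⟨hY⟩
    | succ i ih =>
      intro Z hZ z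
      obtain ⟨E, D, a, b, c, hT', hE, hD⟩ := exists_approximation h _ hZ
      obtain ⟨w, rfl⟩ := exists_desc_of_distTriang hT' z
        (hom_eq_zero_of_coprodSmd (fun j hj ↦ hF j (by have := hj.1; lia)) hE _)
      rw [Category.assoc, ih (by convert! hD using 1; push_cast; lia) w, comp_zero]
  have hYz : IsZero Y := by
    refine hG.2 _ (fun k x ↦ ?_)
    -- `Z` is the extension of `Σᵏ G` by `X` with class `x ≫ d`. It is bounded above and maps to `F`
    -- over `x`, so `b ≫ x = 0`; thus `x` factors through `X⟦1⟧`, which has no nonzero map to `Y`.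
    obtain ⟨Z, a, b, hT'⟩ := distinguished_cocone_triangle₂ (x ≫ d)
    obtain ⟨z, -, hz⟩ := complete_distinguished_triangle_morphism₂ _ _ hT' hT (𝟙 X) x
      (by change (x ≫ d) ≫ (𝟙 X)⟦1⟧' = x ≫ d; simp)
    change Z ⟶ F at z
    change b ≫ x = z ≫ g at hz
    obtain ⟨i, hi⟩ : ∃ i : ℕ, A - k ≤ N + A + i := ⟨(-k - N).toNat, by lia⟩
    have hZ : t.le (N + A + i) Z := (t.isLE₂ _ hT' _ ⟨t.le_monotone (by lia) _ hX⟩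
      ⟨t.le_monotone hi _ (le_shift_of_le hGA k)⟩).le
    rw [key i hZ z] at hz
    obtain ⟨r, hxr⟩ : ∃ r : X⟦(1 : ℤ)⟧ ⟶ Y, x = (x ≫ d) ≫ r :=
      exists_desc_of_distTriang (rot_of_distTriang _ hT') x (hz)
    have hr : r = 0 := t.zero_of_isLE_of_isGE r (N + A - 1) (N + A + 1) (by lia)
      ⟨t.le_shift _ 1 _ (by lia) _ hX⟩ ⟨hY⟩
    rw [hxr, hr, comp_zero]
  have : IsIso f := (Triangle.isZero₃_iff_isIso₁ _ hT).1 hYz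
  exact (t.le _).prop_of_iso (asIso f) hX

/-- In a weakly approximable category, the aisle is contained in a shift of the aisle generated by
the compact generator. -/
lemma le_generatedAisle [IsTriangulated C] [HasCoproducts.{v} C] (hG : IsCompactGenerator G)
    (hA : ∀ X : C, t.le 0 X → ∀ f : G⟦-A⟧ ⟶ X, f = 0)
    (h : ∀ X : C, t.le 0 X → ∃ (E D : C) (f : E ⟶ X) (g : X ⟶ D) (h : D ⟶ E⟦(1 : ℤ)⟧),
      Triangle.mk f g h ∈ distTriang C ∧ coprodSmd G (Set.Icc (-A) A) E ∧ t.le (-1) D) :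
    t.le 0 ≤ generatedAisle G A := by
  intro X hX
  -- Stage `n` is an approximation `E ⟶ X` with cone in `t.le (-n)`; the next stage approximates the
  -- cone.
  let P (n : ℕ) (p : Σ E : C, E ⟶ X) : Prop :=
    ∃ (D : C) (b : X ⟶ D) (c : D ⟶ p.1⟦(1 : ℤ)⟧), Triangle.mk p.2 b c ∈ distTriang C ∧
      generatedAisle G A p.1 ∧ t.le (-n) D
  have hc := isSmdCoprodClosed_coprodSmd G (Set.Iic A)
  obtain ⟨s, hs⟩ := exists_sequence_of_step (S := fun n ↦ { p // P n p })
    ⟨⟨0, 0⟩, X, 𝟙 X, 0, contractible_distinguished₁ X,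
      hc.of_isZero (isZero_zero C), by simpa using hX⟩
    (fun n p p' ↦ ∃ g : p.1.1 ⟶ p'.1.1, g ≫ p'.1.2 = p.1.2) (by
    rintro n ⟨⟨E, e⟩, D, b, c, hT, hE, hD⟩
    change Triangle.mk e b c ∈ distTriang C at hT
    obtain ⟨E₁, D', f, g, d, hT', hE₁, hD'⟩ := exists_approximation h _ hD
    obtain ⟨E', e', c', hT''⟩ := distinguished_cocone_triangle₁ (b ≫ g)
    let o := someOctahedron' rfl hT hT' hT''
    obtain ⟨r, hr⟩ := exists_lift_of_distTriang hT'' e (by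
      rw [← Category.assoc, distTriang_comp₁₂ hT, zero_comp])
    refine ⟨⟨⟨E', e'⟩, D', b ≫ g, c', hT'', hc.ext _ o.mem hE ?_, ?_⟩, r, hr.symm⟩
    · exact coprodSmd_mono G (fun i hi ↦ by have := hi.2; simp only [Set.mem_Iic]; lia) _ hE₁
    · convert! hD' using 1; push_cast; lia)
  choose g hg using hs
  refine hG.prop_of_sequence hc
    (fun X hX ↦ generatedAisle_mono G (by lia) _ (generatedAisle_shift 1 (A - 1) (by lia) hX))
    (fun n ↦ (s n).2.choose_spec.choose_spec.choose_spec.2.1) g (fun n ↦ (s n).1.2) hg (fun k ↦ ?_)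
  -- Surjectivity needs `Hom(Σᵏ G, D) = 0`, that is `n ≥ k + A`; injectivity needs it for `D⟦-1⟧`,
  -- whence the extra `1`.
  refine ⟨(k + A).toNat + 1, fun n hn ↦ ?_⟩
  obtain ⟨D, b, c, hT, -, hD⟩ := (s n).2
  refine ⟨fun x hx ↦ ?_, fun y ↦ ?_⟩
  · obtain ⟨w, rfl⟩ := exists_lift_of_distTriang (inv_rot_of_distTriang _ hT) x hx
    have hw : w = 0 := hom_shift_eq_zero hA (m := -n + 1) (by lia)
      (t.le_shift (-n) (-1) _ (by lia) _ hD) w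
    rw [hw]
    exact zero_comp
  · obtain ⟨x, hx⟩ := exists_lift_of_distTriang hT y (hom_shift_eq_zero hA (by lia) hD _)
    exact ⟨x, hx.symm⟩

end

end Gluing

namespace Gluing

/-! ### The glued generator and the glued t-structure. -/

section

variable {C : Type u} [Category.{v} C] [Preadditive C] [HasZeroObject C] [HasShift C ℤ]
  [∀ n : ℤ, (shiftFunctor C n).Additive] [Pretriangulated C]

lemma IsSmdCoprodClosed.biprod {Q : ObjectProperty C} (hQ : IsSmdCoprodClosed Q) {X Y : C}
    (hX : Q X) (hY : Q Y) : Q (X ⊞ Y) :=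
  hQ.ext _ (binaryBiproductTriangle_distinguished X Y) hX hY

lemma IsCompactGenerator.shift_biprod [HasCoproducts.{v} C] {G K : C} (hG : IsCompactGenerator G)
    (hK : FactorsFinitely K) (m : ℤ) : IsCompactGenerator (G⟦m⟧ ⊞ K) := by
  refine ⟨((hG.factorsFinitely m).biprod hK).isCompactObject, fun X hX ↦ hG.2 X (fun n f ↦ ?_)⟩
  let e : G⟦n⟧ ≅ G⟦m⟧⟦n - m⟧ := (shiftFunctorAdd' C m (n - m) n (by lia)).app G
  have h : (biprod.inl : _ ⟶ G⟦m⟧ ⊞ K)⟦n - m⟧' ≫ biprod.fst⟦n - m⟧' = 𝟙 ((G⟦m⟧)⟦n - m⟧) := by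
    rw [← Functor.map_comp, biprod.inl_fst, CategoryTheory.Functor.map_id]
  have h' := hX (n - m) ((biprod.fst : G⟦m⟧ ⊞ K ⟶ _)⟦n - m⟧' ≫ e.inv ≫ f)
  rw [← cancel_epi e.inv, comp_zero, ← Category.id_comp (e.inv ≫ f), ← h, Category.assoc, h',
    comp_zero]

end

namespace Recollement

variable {DF : Type u₁} [Category.{v} DF] [Preadditive DF] [HasZeroObject DF] [HasShift DF ℤ]
  [∀ n : ℤ, (shiftFunctor DF n).Additive] [Pretriangulated DF]
  {D : Type u₂} [Category.{v} D] [Preadditive D] [HasZeroObject D] [HasShift D ℤ]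
  [∀ n : ℤ, (shiftFunctor D n).Additive] [Pretriangulated D]
  {DU : Type u₃} [Category.{v} DU] [Preadditive DU] [HasZeroObject DU] [HasShift DU ℤ]
  [∀ n : ℤ, (shiftFunctor DU n).Additive] [Pretriangulated DU]
  (R : Recollement DF D DU)

instance : PreservesColimitsOfSize.{v, v} R.iUpper := R.adjI.leftAdjoint_preservesColimits

instance : PreservesColimitsOfSize.{v, v} R.iLower := R.adjI'.leftAdjoint_preservesColimits

instance : PreservesColimitsOfSize.{v, v} R.jShriek := R.adjJ.leftAdjoint_preservesColimits

instance : PreservesColimitsOfSize.{v, v} R.jUpper := R.adjJ'.leftAdjoint_preservesColimits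

variable [HasCoproducts.{v} D]

lemma factorsFinitely_jShriek [HasCoproducts.{v} DU] {K : DU} (hK : FactorsFinitely K) :
    FactorsFinitely (R.jShriek.obj K) :=
  hK.of_adjunction R.adjJ

lemma isCompactGenerator_iUpper [HasCoproducts.{v} DF] {H : D} (hH : IsCompactGenerator H) :
    IsCompactGenerator (R.iUpper.obj H) := by
  refine ⟨(hH.1.factorsFinitely.of_adjunction R.adjI).isCompactObject, fun X hX ↦ ?_⟩
  have h : IsZero (R.iLower.obj X) := hH.2 _ (fun n f ↦ by
    apply (R.adjI.homAddEquiv _ _).symm.injective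
    rw [map_zero, ← cancel_epi ((R.iUpper.commShiftIso n).inv.app H), comp_zero]
    exact hX n _)
  rw [IsZero.iff_id_eq_zero] at h ⊢
  apply R.iLower.map_injective
  rw [CategoryTheory.Functor.map_id, Functor.map_zero, h]

lemma exists_generatedAisle_jUpper [IsTriangulated D] [IsTriangulated DU] [HasCoproducts.{v} DU]
    (hU : IsWeaklyApproximable DU) {G : D} (hG : IsCompactGenerator G) {N : ℤ}
    (hGG : ∀ n : ℤ, N ≤ n → ∀ f : G⟦-n⟧ ⟶ G, f = 0) {GU : DU} (hGU : IsCompactGenerator GU) :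
    ∃ m, generatedAisle GU m (R.jUpper.obj G) := by
  obtain ⟨-, G₀, t, A, hG₀, -, ⟨h₁, h₂⟩, h₃⟩ := hU
  obtain ⟨b, hb⟩ := hG.exists_coprodSmd (R.factorsFinitely_jShriek hG₀.1.factorsFinitely)
  -- `Σ⁻ⁿ j_! G₀` is built from the `Σ⁻ⁱ G` with `i ≥ n - b`, and `n - b ≥ N`.
  have hF (n : ℤ) (hn : N + b ≤ n) (f : G₀⟦-n⟧ ⟶ R.jUpper.obj G) : f = 0 := by
    apply (R.adjJ.homAddEquiv _ _).symm.injective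
    rw [map_zero, ← cancel_epi ((R.jShriek.commShiftIso (-n)).inv.app G₀), comp_zero]
    exact hom_eq_zero_of_coprodSmd (I := Set.Icc (-b + n) (b + n))
      (fun i hi ↦ hGG i (by have := hi.1; lia))
      (coprodSmd_shift_obj (-n)
        (fun i hi ↦ Set.mem_Icc.2 ⟨by have := hi.1; lia, by have := hi.2; lia⟩) hb) _
  have hle := le_of_hom_shift_eq_zero hG₀ h₁ h₃ hF
  have h := generatedAisle_of_shift _ _ rfl
    (le_generatedAisle hG₀ h₂ h₃ _ (t.le_shift _ (N + b + A) 0 (by lia) _ hle))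
  obtain ⟨b', hb'⟩ := hGU.exists_generatedAisle hG₀.1.factorsFinitely
  exact ⟨_, generatedAisle_le hb' _ _ h⟩

lemma generatedAisle_iff [HasCoproducts.{v} DF] [HasCoproducts.{v} DU] {H : D} {GU : DU}
    (h₁ : generatedAisle H 0 (R.jShriek.obj GU)) (h₂ : generatedAisle GU 0 (R.jUpper.obj H))
    (X : D) : generatedAisle H 0 X ↔ generatedAisle (R.iUpper.obj H) 0 (R.iUpper.obj X) ∧
      generatedAisle GU 0 (R.jUpper.obj X) := by
  have hc := isSmdCoprodClosed_coprodSmd H (Set.Iic 0)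
  refine ⟨fun h ↦ ⟨generatedAisle_map R.iUpper (generatedAisle_self _) h,
    generatedAisle_map R.jUpper h₂ h⟩, fun h ↦ ?_⟩
  -- Rotating the triangle at `H` makes `i_* i^* H` an extension of `Σ j_! j^* H` by `H`.
  have h₃ : generatedAisle H 0 (R.iLower.obj (R.iUpper.obj H)) :=
    hc.ext _ (rot_of_distTriang _ (R.triangle H)) (generatedAisle_self H)
      (generatedAisle_mono H (by lia) _
        (generatedAisle_shift 1 (-1) (by lia) (generatedAisle_map R.jShriek h₁ h₂)))
  exact hc.ext _ (R.triangle X) (generatedAisle_map R.jShriek h₁ h.2)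
    (generatedAisle_map R.iLower h₃ h.1)

theorem exists_glued_generator [IsTriangulated D] [IsTriangulated DU] [HasCoproducts.{v} DF]
    [HasCoproducts.{v} DU] (hU : IsWeaklyApproximable DU) {G : D} (hG : IsCompactGenerator G)
    {N : ℤ} (hGG : ∀ n : ℤ, N ≤ n → ∀ f : G⟦-n⟧ ⟶ G, f = 0) {GU : DU}
    (hGU : IsCompactGenerator GU) :
    ∃ H : D, IsCompactGenerator H ∧ ∀ X : D, generatedAisle H 0 X ↔
      generatedAisle (R.iUpper.obj H) 0 (R.iUpper.obj X) ∧
        generatedAisle GU 0 (R.jUpper.obj X) := by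
  obtain ⟨m, hm⟩ := R.exists_generatedAisle_jUpper hU hG hGG hGU
  refine ⟨G⟦m⟧ ⊞ R.jShriek.obj GU,
    hG.shift_biprod (R.factorsFinitely_jShriek hGU.1.factorsFinitely) m,
    R.generatedAisle_iff ?_ ?_⟩
  · exact (isSmdCoprodClosed_coprodSmd _ _).retract ⟨biprod.inr, biprod.snd, by simp⟩
      (generatedAisle_self _)
  · have hc := isSmdCoprodClosed_coprodSmd GU (Set.Iic 0)
    refine (hc.comap R.jUpper).biprod ?_ ?_
    · exact hc.iso ((R.jUpper.commShiftIso m).app G).symm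
        (generatedAisle_shift m 0 (by lia) hm)
    · exact hc.iso (asIso (R.adjJ.unit.app GU)) (generatedAisle_self GU)

theorem inPreferredClass_glue [IsTriangulated D] [IsTriangulated DF] [HasCoproducts.{v} DF]
    [HasCoproducts.{v} DU] {H : D} (hH : IsCompactGenerator H) {GU : DU}
    (h : ∀ X : D, generatedAisle H 0 X ↔ generatedAisle (R.iUpper.obj H) 0 (R.iUpper.obj X) ∧
      generatedAisle GU 0 (R.jUpper.obj X))
    {tF : TStructure DF} {tU : TStructure DU} (hF : InPreferredClass tF)
    (hU : EquivalentAisles (generatedAisle GU) tU.le) : InPreferredClass (R.glue tF tU) := by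
  have h' (n : ℤ) (X : D) : generatedAisle H n X ↔
      generatedAisle (R.iUpper.obj H) n (R.iUpper.obj X) ∧
        generatedAisle GU n (R.jUpper.obj X) := by
    have hF := isSmdCoprodClosed_coprodSmd (R.iUpper.obj H) (Set.Iic 0)
    have hU := isSmdCoprodClosed_coprodSmd GU (Set.Iic 0)
    constructor
    · intro hX
      have := (h _).1 (generatedAisle_shift n 0 (by lia) hX)
      exact ⟨generatedAisle_of_shift n 0 (by lia) (hF.iso ((R.iUpper.commShiftIso n).app X) this.1),
        generatedAisle_of_shift n 0 (by lia) (hU.iso ((R.jUpper.commShiftIso n).app X) this.2)⟩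
    · rintro ⟨hXF, hXU⟩
      exact generatedAisle_of_shift n 0 (by lia) ((h _).2
        ⟨hF.iso ((R.iUpper.commShiftIso n).app X).symm (generatedAisle_shift n 0 (by lia) hXF),
          hU.iso ((R.jUpper.commShiftIso n).app X).symm (generatedAisle_shift n 0 (by lia) hXU)⟩)
  obtain ⟨GF, hGF, AF, hAF, hF₁, hF₂⟩ := hF
  obtain ⟨AU, hAU, hU₁, hU₂⟩ := hU
  have hiH := R.isCompactGenerator_iUpper hH
  obtain ⟨b, hb⟩ := hGF.exists_generatedAisle hiH.1.factorsFinitely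
  obtain ⟨b', hb'⟩ := hiH.exists_generatedAisle hGF.1.factorsFinitely
  -- `b` and `b'` are the costs of exchanging `GF` and `i^* H` in the two directions; on `DU` the
  -- generator is the same on both sides, so `AU` suffices.
  refine ⟨H, hH, max AU (AF + max b b'), by lia, fun X hX ↦ ?_, fun X hX ↦ ?_⟩
  · rw [h'] at hX
    exact ⟨hF₁ _ (generatedAisle_mono _ (by lia) _ (generatedAisle_le hb _ _ hX.1)),
      hU₁ _ (generatedAisle_mono _ (by lia) _ hX.2)⟩
  · rw [h']
    exact ⟨generatedAisle_mono _ (by lia) _ (generatedAisle_le hb' _ _ (hF₂ _ hX.1)),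
      generatedAisle_mono _ (by lia) _ (hU₂ _ hX.2)⟩

end Recollement

end Gluing

theorem corollary1
    {DF : Type u₁} [Category.{v} DF] [Preadditive DF] [HasZeroObject DF] [HasShift DF ℤ]
    [∀ n : ℤ, (shiftFunctor DF n).Additive] [Pretriangulated DF] [IsTriangulated DF]
    [HasCoproducts.{v} DF]
    {D : Type u₂} [Category.{v} D] [Preadditive D] [HasZeroObject D] [HasShift D ℤ]
    [∀ n : ℤ, (shiftFunctor D n).Additive] [Pretriangulated D] [IsTriangulated D]
    [HasCoproducts.{v} D]
    {DU : Type u₃} [Category.{v} DU] [Preadditive DU] [HasZeroObject DU] [HasShift DU ℤ]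
    [∀ n : ℤ, (shiftFunctor DU n).Additive] [Pretriangulated DU] [IsTriangulated DU]
    [HasCoproducts.{v} DU]
    (R : Gluing.Recollement DF D DU)
    (hU : Gluing.IsWeaklyApproximable DU)
    (G : D) (hG : Gluing.IsCompactGenerator G)
    (hGG : ∃ N : ℤ, ∀ n : ℤ, N ≤ n → ∀ f : G⟦-n⟧ ⟶ G, f = 0) :
    (∀ GU : DU, Gluing.IsCompactGenerator GU →
      ∃ H : D, Gluing.IsCompactGenerator H ∧
        ∀ X : D, Gluing.generatedAisle H 0 X ↔
          Gluing.generatedAisle (R.iUpper.obj H) 0 (R.iUpper.obj X) ∧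
            Gluing.generatedAisle GU 0 (R.jUpper.obj X)) ∧
    ∀ (tF : TStructure DF) (tU : TStructure DU),
      Gluing.InPreferredClass tF → Gluing.InPreferredClass tU →
        Gluing.InPreferredClass (R.glue tF tU) := by
  obtain ⟨N, hN⟩ := hGG
  refine ⟨fun GU hGU ↦ R.exists_glued_generator hU hG hN hGU, ?_⟩
  -- Part (a) is applied to the very generator `GU` that witnesses the class of `tU`, so no
  -- comparison of generators of `DU` is needed here.
  rintro tF tU hF ⟨GU, hGU, hE⟩
  obtain ⟨H, hH, h⟩ := R.exists_glued_generator hU hG hN hGU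
  exact R.inPreferredClass_glue hH h hF hE
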